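/- **Conventions.** Alphabets are finite. The size $|\mathcal R|$ of a finite representation $\mathcal R$ of a language is the length of its usual binary encoding. A class $\mathcal C_1$ of representations *can be exponentially more succinct* than a class $\mathcal C_2$ if for every function $f\in 2^{o(n)}$ there is $\mathcal R_1\in\mathcal C_1$ such that every $\mathcal R_2\in\mathcal C_2$ representing the same language (over the same alphabet) as $\mathcal R_1$ satisfies $|\mathcal R_2|>f(|\mathcal R_1|)$. *UHATs.* A masked unique hard-attention transformer (UHAT) over $\Sigma$ consists of a token embedding $\Sigma\to\mathbb Q^d$ ($d>0$), a finite sequence of UHA layers and ReLU layers of matching widths, an acceptance vector $t\in\mathbb Q^s$ and an output position (first or last). A UHA layer of width $r>0$ is given by rational affine maps $A,B:\mathbb Q^r\to\mathbb Q^r$, $C:\mathbb Q^{2r}\to\mathbb Q^{s'}$, a mask $M(i,j)$ (always true, $j<i$, or $j>i$) and a tie-breaking rule $\tau\in\{\min,\max\}$. It maps $v_1,\dots,v_n$ to $C(v_1,a_1),\dots,C(v_n,a_n)$, where $a_i=v_{\tau(B_i)}$, $B_i$ is the set of those $j$ with $M(i,j)$ that maximize $\langle A(v_i),B(v_j)\rangle$,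 and $a_i=0$ if there is no $j$ with $M(i,j)$. A ReLU layer replaces a fixed coordinate $x$ of each vector by $\max\{0,x\}$. A non-empty word is accepted iff $\langle t,v\rangle>0$ for the output vector $v$ at the output position; the empty word is not accepted. *Fixed-precision RNNs.* A recurrent neural network (RNN) over $\Sigma$ with precision $k$ and dimension $d$ consists of an initial vector $x_0\in(\{0,1\}^k)^d$, a token embedding $\mathrm{emb}:\Sigma\to(\{0,1\}^k)^e$, an update function $g:(\{0,1\}^k)^d\times(\{0,1\}^k)^e\to(\{0,1\}^k)^d$ and a final function $(\{0,1\}^k)^d\to\{\mathrm{Acc},\mathrm{Rej}\}$. It accepts $a_1\cdots a_n$ iff the final function accepts $x_n$, where $x_{i+1}=g(x_i,\mathrm{emb}(a_{i+1}))$. Its binary encoding lists $k$ in unary, the dimensions, the embedding, $x_0$, and code words (bit strings) for the update and the final function; the code in which these functions are written is arbitrary and may differ between RNNs. **Statement.** 1. Every RNN with precision $k$ and dimension $d$ recognizes the same language as some deterministic finite automaton with $2^{kd}$ states. 2. UHATs can be exponentially more succinct than fixed-precision RNNs: for every $f\in 2^{o(n)}$ there is a UHAT $\mathcal T$ such that every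 fixed-precision RNN $\mathcal R$ recognizing the same language as $\mathcal T$ satisfies $|\mathcal R|>f(|\mathcal T|)$. -/

import Mathlib

namespace Succinct

/-- A class of finite representations of languages. The alphabet of a representation is
`Fin σ` for some `σ`; every representation has a binary encoding and denotes a language. -/
structure RepClass where
  Rep : ℕ → Type
  lang : {σ : ℕ} → Rep σ → Language (Fin σ)
  encode : {σ : ℕ} → Rep σ → List Bool

/-- The size of a representation is the length of its binary encoding. -/
def RepClass.size (C : RepClass) {σ : ℕ} (R : C.Rep σ) : ℕ := (C.encode R).length

/-- `f ∈ 2^{o(n)}`. -/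
def InTwoPowLittleO (f : ℕ → ℝ) : Prop :=
  ∃ g : ℕ → ℝ, g =o[Filter.atTop] (fun n : ℕ => (n : ℝ)) ∧ ∀ n, f n ≤ (2 : ℝ) ^ g n

/-- `C₁` can be exponentially more succinct than `C₂`. -/
def CanBeExpMoreSuccinct (C₁ C₂ : RepClass) : Prop :=
  ∀ f : ℕ → ℝ, InTwoPowLittleO f →
    ∃ (σ : ℕ) (R₁ : C₁.Rep σ), ∀ R₂ : C₂.Rep σ,
      C₂.lang R₂ = C₁.lang R₁ → f (C₁.size R₁) < (C₂.size R₂ : ℝ)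

section Encodings

/-- Self-delimiting code of a bit string: every bit is preceded by `true`, and a `false` marks
the end. -/
def encBits (l : List Bool) : List Bool := l.flatMap (fun b => [true, b]) ++ [false]

/-- Binary code of a natural number. -/
def encNat (n : ℕ) : List Bool := encBits n.bits

/-- Unary code of a natural number. -/
def encUnary (n : ℕ) : List Bool := List.replicate n true ++ [false]

/-- Binary code of a rational number: sign, numerator and denominator. -/
def encRat (q : ℚ) : List Bool :=
  decide (q.num < 0) :: (encNat q.num.natAbs ++ encNat q.den)

/-- Concatenation of the codes of the entries of a family. -/
def encFam {α : Type} {n : ℕ} (enc : α → List Bool) (v : Fin n → α) : List Bool :=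
  (List.ofFn (fun i => enc (v i))).flatten

end Encodings

section Transformers

/-- An affine transformation `x ↦ Q x + b` with rational coefficients. -/
structure Affine (m n : ℕ) where
  mat : Matrix (Fin n) (Fin m) ℚ
  bias : Fin n → ℚ

def Affine.apply {m n : ℕ} (T : Affine m n) (x : Fin m → ℚ) : Fin n → ℚ :=
  T.mat.mulVec x + T.bias

def Affine.encode {m n : ℕ} (T : Affine m n) : List Bool :=
  encFam (fun row : Fin m → ℚ => encFam encRat row) T.mat ++ encFam encRat T.bias

/-- Mask predicates: no masking, strict future masking (`j < i`), strict past masking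
(`j > i`). -/
inductive Mask
  | noMask
  | strictFuture
  | strictPast

/-- `M.allows i j`: position `i` may attend to position `j`. -/
def Mask.allows : Mask → ℕ → ℕ → Bool
  | .noMask, _, _ => true
  | .strictFuture, i, j => decide (j < i)
  | .strictPast, i, j => decide (i < j)

def Mask.encode : Mask → List Bool
  | .noMask => [false, false]
  | .strictFuture => [true, false]
  | .strictPast => [true, true]

/-- Tie-breaking functions `min` and `max`. -/
inductive TieBreak
  | leftmost
  | rightmost

def TieBreak.select {n : ℕ} : TieBreak → (s : Finset (Fin n)) → s.Nonempty → Fin n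
  | .leftmost, s, h => s.min' h
  | .rightmost, s, h => s.max' h

def TieBreak.encode : TieBreak → List Bool
  | .leftmost => [false]
  | .rightmost => [true]

/-- A masked unique hard-attention layer of width `r` and output dimension `s`. -/
structure UHALayer (r s : ℕ) where
  width_pos : 0 < r
  A : Affine r r
  B : Affine r r
  C : Affine (r + r) s
  mask : Mask
  tie : TieBreak

namespace UHALayer

variable {r s n : ℕ} (L : UHALayer r s) (v : Fin n → Fin r → ℚ)

/-- The score function `⟨A(v_i), B(v_j)⟩`. -/
def score (i j : Fin n) : ℚ := dotProduct (L.A.apply (v i)) (L.B.apply (v j))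

/-- The set `U_i` of unmasked positions. -/
def unmasked (n : ℕ) (i : Fin n) : Finset (Fin n) :=
  Finset.univ.filter (fun j => L.mask.allows i j = true)

/-- The set `B_i` of unmasked positions that maximize the score. -/
def best (i : Fin n) : Finset (Fin n) :=
  (L.unmasked n i).filter (fun j => ∀ j' ∈ L.unmasked n i, L.score v i j' ≤ L.score v i j)

theorem best_nonempty (i : Fin n) (h : (L.unmasked n i).Nonempty) : (L.best v i).Nonempty := by
  obtain ⟨j, hj, hmax⟩ := Finset.exists_max_image _ (L.score v i) h
  exact ⟨j, Finset.mem_filter.mpr ⟨hj, hmax⟩⟩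

/-- The attention vector at position `i`. -/
def attention (i : Fin n) : Fin r → ℚ :=
  if h : (L.unmasked n i).Nonempty then
    v (L.tie.select (L.best v i) (L.best_nonempty v i h))
  else 0

/-- The output sequence `C(v_1, a_1), …, C(v_n, a_n)`. -/
def run : Fin n → Fin s → ℚ :=
  fun i => L.C.apply (Fin.append (v i) (L.attention v i))

def encode : List Bool :=
  encNat s ++ L.A.encode ++ L.B.encode ++ L.C.encode ++ L.mask.encode ++ L.tie.encode

end UHALayer

/-- The ReLU layer on coordinate `k`. -/
def reluRun {r n : ℕ} (k : Fin r) (v : Fin n → Fin r → ℚ) : Fin n → Fin r → ℚ :=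
  fun i => Function.update (v i) k (max 0 (v i k))

/-- A sequence of UHA layers and ReLU layers of matching width, from dimension `r` to
dimension `t`. -/
inductive Layers : ℕ → ℕ → Type
  | nil (r : ℕ) : Layers r r
  | uha {r s t : ℕ} (L : UHALayer r s) (rest : Layers s t) : Layers r t
  | relu {r t : ℕ} (k : Fin r) (rest : Layers r t) : Layers r t

/-- Application of the layers, the head of the sequence first. -/
def Layers.run {n : ℕ} : {r t : ℕ} → Layers r t → (Fin n → Fin r → ℚ) → (Fin n → Fin t → ℚ)
  | _, _, .nil _, v => v
  | _, _, .uha L rest, v => rest.run (L.run v)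
  | _, _, .relu k rest, v => rest.run (reluRun k v)

def Layers.encode : {r t : ℕ} → Layers r t → List Bool
  | _, _, .nil _ => [false]
  | _, _, .uha L rest => [true, false] ++ L.encode ++ rest.encode
  | _, _, .relu k rest => [true, true] ++ encNat k ++ rest.encode

/-- The output position: first or last. -/
inductive OutPos
  | first
  | last

def OutPos.index {n : ℕ} (h : 0 < n) : OutPos → Fin n
  | .first => ⟨0, h⟩
  | .last => ⟨n - 1, Nat.sub_lt h Nat.one_pos⟩

def OutPos.encode : OutPos → List Bool
  | .first => [false]
  | .last => [true]

/-- A masked unique hard-attention transformer over the alphabet `Fin σ`, given with its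
acceptance vector and its output position. -/
structure UHAT (σ : ℕ) where
  d : ℕ
  d_pos : 0 < d
  s : ℕ
  emb : Fin σ → Fin d → ℚ
  layers : Layers d s
  acc : Fin s → ℚ
  out : OutPos

namespace UHAT

variable {σ : ℕ} (T : UHAT σ)

/-- The output sequence on the word `w`. -/
def run (w : List (Fin σ)) : Fin w.length → Fin T.s → ℚ :=
  T.layers.run (fun i => T.emb (w.get i))

/-- The recognized language. The empty word has no output position and is not accepted. -/
def lang : Language (Fin σ) :=
  {w | ∃ h : 0 < w.length, 0 < dotProduct T.acc (T.run w (T.out.index h))}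

def encode : List Bool :=
  encNat σ ++ encNat T.d ++ encFam (fun x : Fin T.d → ℚ => encFam encRat x) T.emb ++
    T.layers.encode ++ encFam encRat T.acc ++ T.out.encode

end UHAT

/-- The class of UHATs. -/
def uhatClass : RepClass where
  Rep := UHAT
  lang := fun T => T.lang
  encode := fun T => T.encode

end Transformers

section RecurrentNetworks

/-- `d`-vectors of numbers with `k` bits of precision. -/
abbrev FPVec (k d : ℕ) : Type := Fin d → Fin k → Bool

/-- A way to write down the functions of recurrent networks as bit strings: for precision `k`,
state dimension `d` and embedding dimension `e`, a bit string (for instance a list of weights for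
some fixed architecture and arithmetic) denotes an update function, and another one denotes a
final function. Nothing is assumed about it, so every architecture, every number format and every
rounding mode is covered. -/
structure RNNFormat where
  step : (k d e : ℕ) → List Bool → FPVec k d → FPVec k e → FPVec k d
  final : (k d : ℕ) → List Bool → FPVec k d → Bool

/-- A recurrent neural network with fixed precision over the alphabet `Fin σ`, its functions
being written in the format `F`. -/
structure RNN (F : RNNFormat) (σ : ℕ) where
  precision : ℕ
  dim : ℕ
  embDim : ℕ
  emb : Fin σ → FPVec precision embDim
  init : FPVec precision dim
  stepCode : List Bool
  finalCode : List Bool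

namespace RNN

variable {F : RNNFormat} {σ : ℕ} (R : RNN F σ)

/-- The update function `g`, composed with the token embedding. -/
def step (x : FPVec R.precision R.dim) (a : Fin σ) : FPVec R.precision R.dim :=
  F.step R.precision R.dim R.embDim R.stepCode x (R.emb a)

/-- The state `x_n` reached on a word of length `n`. -/
def state (w : List (Fin σ)) : FPVec R.precision R.dim := w.foldl R.step R.init

/-- The accepted language. -/
def lang : Language (Fin σ) :=
  {w | F.final R.precision R.dim R.finalCode (R.state w) = true}

/-- The binary encoding, with the precision in unary. -/
def encode : List Bool :=
  encUnary R.precision ++ encNat σ ++ encNat R.dim ++ encNat R.embDim ++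
    encFam (fun x : FPVec R.precision R.embDim => encFam List.ofFn x) R.emb ++
    encFam List.ofFn R.init ++ encBits R.stepCode ++ encBits R.finalCode

end RNN

/-- The class of fixed-precision RNNs, in all formats. -/
def rnnClass : RepClass where
  Rep := fun σ => Σ F : RNNFormat, RNN F σ
  lang := fun R => R.2.lang
  encode := fun R => R.2.encode

end RecurrentNetworks

end Succinct

/-!
Over the letters `0`, `1`, `2`, where `2` closes a block of bits, consider the words whose last
`t` letters do not reoccur at an earlier separator. If all blocks have `N` bits and `t = N + 1`,
then a list of blocks enumerating a set `S ⊆ {0,1}^N`, followed by the block of `x`, is such a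
word iff `x ∉ S`. Hence the language has `2 ^ 2 ^ N` left quotients, and an automaton for it has
at least as many states; as an RNN is an automaton with `2 ^ (k * d)` states, its size, which is
at least `k * d`, is at least `2 ^ N`.

A UHAT with `t` copies of one layer of constant size suffices. The copies compute at each position
the number `x ∈ [0, 1)` whose binary expansion is the window of the last `t` letters, together with
`x ^ 2`: prepending the bit `b` turns `x` into `(b + x) / 2`, and the mixed term `b * x` of its
square is `max 0 (b + x - 1)`. Among the earlier positions, the score
`2 * xᵢ * xⱼ - xⱼ ^ 2 + 2 * [j is a separator]` is then maximal at a separator with `xⱼ = xᵢ` if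
there is one.
-/

namespace Succinct

section Automata

theorem card_le_card_states_of_injective_leftQuotient {α S ι : Type*} [Fintype S] [Fintype ι]
    (M : DFA α S) (p : ι → List α)
    (hp : Function.Injective fun i => M.accepts.leftQuotient (p i)) :
    Fintype.card ι ≤ Fintype.card S := by
  simp only [Language.leftQuotient_accepts_apply] at hp
  exact Fintype.card_le_of_injective (fun i => M.eval (p i)) (.of_comp (f := M.acceptsFrom) hp)

end Automata

section RecurrentNetworkBounds

variable {F : RNNFormat} {σ : ℕ} (R : RNN F σ)

theorem card_fpVec (k d : ℕ) : Fintype.card (FPVec k d) = 2 ^ (k * d) := by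
  simp only [FPVec, Fintype.card_fun, Fintype.card_bool, Fintype.card_fin, pow_mul]

/-- The deterministic automaton whose states are the states of the network. -/
def RNN.toDFA : DFA (Fin σ) (FPVec R.precision R.dim) where
  step := R.step
  start := R.init
  accept := {x | F.final R.precision R.dim R.finalCode x = true}

theorem RNN.accepts_toDFA : R.toDFA.accepts = R.lang := rfl

theorem RNN.exists_dfa_accepts_eq_lang :
    ∃ A : DFA (Fin σ) (Fin (2 ^ (R.precision * R.dim))), A.accepts = R.lang :=
  ⟨DFA.reindex (Fintype.equivFinOfCardEq (card_fpVec _ _)) R.toDFA, by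
    rw [DFA.accepts_reindex, R.accepts_toDFA]⟩

theorem length_encFam_ofFn {k d : ℕ} (x : FPVec k d) : (encFam List.ofFn x).length = k * d := by
  simp [encFam, List.length_flatten, List.map_ofFn, Function.comp_def, mul_comm]

theorem RNN.precision_mul_dim_le_length_encode : R.precision * R.dim ≤ R.encode.length := by
  simp only [RNN.encode, List.length_append, length_encFam_ofFn R.init]
  omega

end RecurrentNetworkBounds

section Succinctness

theorem exists_forall_le_mul_add_of_isLittleO {g : ℕ → ℝ}
    (hg : g =o[Filter.atTop] fun n : ℕ => (n : ℝ)) {ε : ℝ} (hε : 0 < ε) :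
    ∃ K, ∀ n, g n ≤ ε * n + K := by
  obtain ⟨n₀, hn₀⟩ := Filter.eventually_atTop.1 (hg.bound hε)
  refine ⟨∑ m ∈ Finset.range n₀, |g m|, fun n => (le_abs_self _).trans ?_⟩
  rcases lt_or_ge n n₀ with hn | hn
  · exact (Finset.single_le_sum (f := fun m => |g m|) (fun m _ => abs_nonneg _)
      (Finset.mem_range.2 hn)).trans (le_add_of_nonneg_left (by positivity))
  · have hgn : |g n| ≤ ε * n := by simpa using hn₀ n hn
    exact hgn.trans (le_add_of_nonneg_right (by positivity))

theorem canBeExpMoreSuccinct_of_linear_of_exponential {C₁ C₂ : RepClass} {σ : ℕ → ℕ}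
    (R : ∀ N, C₁.Rep (σ N)) (a b : ℕ) (upper : ∀ N, C₁.size (R N) ≤ a + b * N)
    (lower : ∀ N (R₂ : C₂.Rep (σ N)), C₂.lang R₂ = C₁.lang (R N) → 2 ^ N ≤ C₂.size R₂) :
    CanBeExpMoreSuccinct C₁ C₂ := by
  rintro f ⟨g, hg, hfg⟩
  have hb : (0 : ℝ) < b + 1 := by positivity
  obtain ⟨K, hK⟩ := exists_forall_le_mul_add_of_isLittleO hg (inv_pos.2 hb)
  obtain ⟨N, hN⟩ := exists_nat_gt (a + (b + 1) * K)
  refine ⟨σ N, R N, fun R₂ hR₂ => ?_⟩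
  have hexp : g (C₁.size (R N)) < N := by
    have hsize : (C₁.size (R N) : ℝ) ≤ a + b * N := by exact_mod_cast upper N
    calc g (C₁.size (R N)) ≤ (b + 1 : ℝ)⁻¹ * C₁.size (R N) + K := hK _
      _ ≤ (b + 1 : ℝ)⁻¹ * (a + b * N) + K := by gcongr
      _ = (a + b * N + (b + 1) * K) / (b + 1) := by field_simp
      _ < N := by rw [div_lt_iff₀ hb]; linarith
  calc f (C₁.size (R N)) ≤ (2 : ℝ) ^ g (C₁.size (R N)) := hfg _
    _ < (2 : ℝ) ^ (N : ℝ) := Real.rpow_lt_rpow_of_exponent_lt one_lt_two hexp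
    _ = ((2 ^ N : ℕ) : ℝ) := by rw [Real.rpow_natCast]; push_cast; rfl
    _ ≤ C₂.size R₂ := by exact_mod_cast lower N R₂ hR₂

end Succinctness

section BinaryFraction

/-- The number in `[0, 1)` whose binary expansion is the list read from its end: the last bit is
the most significant one. -/
def binaryFraction (x : List Bool) : ℚ := x.foldl (fun q b => (b.toNat + q) / 2) 0

theorem binaryFraction_nil : binaryFraction [] = 0 := rfl

theorem binaryFraction_concat (x : List Bool) (b : Bool) :
    binaryFraction (x ++ [b]) = (b.toNat + binaryFraction x) / 2 := by
  simp only [binaryFraction, List.foldl_append, List.foldl_cons, List.foldl_nil]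

theorem binaryFraction_mem_Ico (x : List Bool) : binaryFraction x ∈ Set.Ico 0 1 := by
  induction x using List.reverseRecOn with
  | nil => simp [binaryFraction_nil]
  | append_singleton x b ih =>
    obtain ⟨hnonneg, hlt⟩ := ih
    rw [binaryFraction_concat]
    cases b <;> constructor <;> norm_num <;> linarith

theorem toNat_add_inj_of_mem_Ico {a b : Bool} {p q : ℚ} (hp : p ∈ Set.Ico 0 1)
    (hq : q ∈ Set.Ico 0 1) (h : (a.toNat : ℚ) + p = b.toNat + q) : a = b ∧ p = q := by
  obtain ⟨hp₀, hp₁⟩ := hp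
  obtain ⟨hq₀, hq₁⟩ := hq
  cases a <;> cases b <;> norm_num at h ⊢ <;> linarith

theorem eq_of_binaryFraction_eq {x y : List Bool} (hlen : x.length = y.length)
    (h : binaryFraction x = binaryFraction y) : x = y := by
  induction x using List.reverseRecOn generalizing y with
  | nil => exact (List.length_eq_zero_iff.1 hlen.symm).symm
  | append_singleton x a ih =>
    obtain rfl | ⟨y, b, rfl⟩ := List.eq_nil_or_concat' y
    · simp at hlen
    · rw [binaryFraction_concat, binaryFraction_concat, div_left_inj' two_ne_zero] at h
      obtain ⟨rfl, hxy⟩ := toNat_add_inj_of_mem_Ico (binaryFraction_mem_Ico x)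
        (binaryFraction_mem_Ico y) h
      rw [ih (by simpa using hlen) hxy]

theorem max_zero_toNat_add_sub_one (b : Bool) {q : ℚ} (hq : q ∈ Set.Ico 0 1) :
    max 0 (b.toNat + q - 1) = b.toNat * q := by
  obtain ⟨hq₀, hq₁⟩ := hq
  cases b
  · simp [hq₁.le]
  · simp [hq₀]

end BinaryFraction

section FreshWindow

/-- The value of the window of the last `t` letters of a word, in which the separator `2` counts
as the bit `0`, and a word shorter than `t` is padded with zeros in front. -/
def windowValue (t : ℕ) (u : List (Fin 3)) : ℚ :=
  binaryFraction ((u.rtake t).map fun a => decide (a = 1))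

theorem windowValue_zero (u : List (Fin 3)) : windowValue 0 u = 0 := by
  simp [windowValue, binaryFraction_nil]

theorem windowValue_nil (t : ℕ) : windowValue t [] = 0 := by
  simp [windowValue, binaryFraction_nil]

theorem windowValue_succ_concat (t : ℕ) (u : List (Fin 3)) (a : Fin 3) :
    windowValue (t + 1) (u ++ [a]) = ((decide (a = 1)).toNat + windowValue t u) / 2 := by
  simp only [windowValue, List.rtake_concat_succ, List.map_append, List.map_cons, List.map_nil,
    binaryFraction_concat]

theorem windowValue_mem_Ico (t : ℕ) (u : List (Fin 3)) : windowValue t u ∈ Set.Ico 0 1 :=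
  binaryFraction_mem_Ico _

/-- The words whose final window of length `t` differs, in value, from the windows that end at an
earlier separator `2`. -/
def freshWindowLanguage (t : ℕ) : Language (Fin 3) :=
  {w | w ≠ [] ∧ ∀ u, u ++ [2] <+: w → u ++ [2] ≠ w → windowValue t (u ++ [2]) ≠ windowValue t w}

theorem mem_freshWindowLanguage {t : ℕ} {w : List (Fin 3)} :
    w ∈ freshWindowLanguage t ↔ w ≠ [] ∧ ∀ u, u ++ [2] <+: w → u ++ [2] ≠ w →
      windowValue t (u ++ [2]) ≠ windowValue t w := Iff.rfl

end FreshWindow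

section Blocks

theorem concat_isPrefix_append_iff_of_notMem {α : Type*} {a : α} (u l : List α) {l' : List α}
    (ha : a ∉ l') : u ++ [a] <+: l ++ l' ↔ u ++ [a] <+: l := by
  induction l' using List.reverseRecOn with
  | nil => rw [List.append_nil]
  | append_singleton l' b ih =>
    simp only [List.mem_append, List.mem_singleton, not_or] at ha
    rw [← List.append_assoc, List.prefix_concat_iff, ih ha.1, or_iff_right]
    intro h
    exact ha.2 (List.append_inj' h rfl |>.2 |> List.singleton_inj.1)

/-- The binary word `x` over the letters `0` and `1`, closed by the separator `2`. -/
def block (x : List Bool) : List (Fin 3) := x.map (fun b => if b then 1 else 0) ++ [2]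

/-- The concatenation of the blocks of a list of binary words. -/
def blocks (xs : List (List Bool)) : List (Fin 3) := xs.flatMap block

theorem blocks_append (xs ys : List (List Bool)) : blocks (xs ++ ys) = blocks xs ++ blocks ys :=
  List.flatMap_append

theorem blocks_concat (xs : List (List Bool)) (x : List Bool) :
    blocks (xs ++ [x]) = blocks xs ++ block x := by
  simp [blocks]

theorem blocks_isPrefix {xs ys : List (List Bool)} (h : xs <+: ys) : blocks xs <+: blocks ys := by
  obtain ⟨zs, rfl⟩ := h
  exact ⟨blocks zs, (blocks_append _ _).symm⟩

theorem exists_blocks_eq_of_isPrefix {u : List (Fin 3)} {xs : List (List Bool)}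
    (h : u ++ [2] <+: blocks xs) : ∃ l x, l ++ [x] <+: xs ∧ u ++ [2] = blocks (l ++ [x]) := by
  induction xs using List.reverseRecOn with
  | nil => simp [blocks] at h
  | append_singleton xs x ih =>
    rw [blocks_concat, block, ← List.append_assoc, List.prefix_concat_iff,
      concat_isPrefix_append_iff_of_notMem _ _ (by simp)] at h
    rcases h with h | h
    · exact ⟨xs, x, List.prefix_rfl, by rw [h, blocks_concat, block, List.append_assoc]⟩
    · obtain ⟨l, y, hl, hu⟩ := ih h
      exact ⟨l, y, hl.trans (List.prefix_append _ _), hu⟩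

theorem windowValue_blocks_concat {N : ℕ} (xs : List (List Bool)) {x : List Bool}
    (hx : x.length = N) :
    windowValue (N + 1) (blocks (xs ++ [x])) = binaryFraction x / 2 := by
  subst hx
  rw [blocks_concat, block, ← List.append_assoc, windowValue_succ_concat, windowValue]
  simp [List.rtake, Function.comp_def]

theorem blocks_concat_mem_freshWindowLanguage_iff {N : ℕ} {xs : List (List Bool)} {x : List Bool}
    (hxs : ∀ y ∈ xs, y.length = N) (hx : x.length = N) :
    blocks (xs ++ [x]) ∈ freshWindowLanguage (N + 1) ↔ x ∉ xs := by
  rw [mem_freshWindowLanguage, and_iff_right (by simp [blocks, block])]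
  constructor
  · intro hfresh hmem
    obtain ⟨l, r, rfl⟩ := List.append_of_mem hmem
    obtain ⟨u, hu⟩ : ∃ u, u ++ [2] = blocks (l ++ [x]) :=
      ⟨blocks l ++ x.map _, by rw [blocks_concat, block, List.append_assoc]⟩
    have hprefix : l ++ [x] <+: l ++ x :: r ++ [x] := ⟨r ++ [x], by simp⟩
    refine hfresh u (hu ▸ blocks_isPrefix hprefix) ?_ ?_
    · rw [hu]
      simp [blocks, block]
    · rw [hu, windowValue_blocks_concat l hx, windowValue_blocks_concat _ hx]
  · intro hmem u hu hne heq
    obtain ⟨l, y, hl, hu'⟩ := exists_blocks_eq_of_isPrefix hu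
    rw [hu'] at hne heq
    have hy : y ∈ xs := by
      rcases List.prefix_concat_iff.1 hl with h | h
      · exact absurd (congrArg blocks h) hne
      · exact h.subset (by simp)
    rw [windowValue_blocks_concat l (hxs y hy), windowValue_blocks_concat xs hx,
      div_left_inj' two_ne_zero] at heq
    exact hmem (eq_of_binaryFraction_eq ((hxs y hy).trans hx.symm) heq ▸ hy)

theorem injective_leftQuotient_freshWindowLanguage (N : ℕ) :
    Function.Injective fun S : Finset (Fin N → Bool) =>
      (freshWindowLanguage (N + 1)).leftQuotient (blocks (S.toList.map List.ofFn)) := by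
  have hmem : ∀ (S : Finset (Fin N → Bool)) (x : Fin N → Bool),
      block (List.ofFn x) ∈ (freshWindowLanguage (N + 1)).leftQuotient
        (blocks (S.toList.map List.ofFn)) ↔ x ∉ S := fun S x => by
    rw [Language.mem_leftQuotient, ← blocks_concat,
      blocks_concat_mem_freshWindowLanguage_iff (by simp) (by simp)]
    simp [List.ofFn_injective.eq_iff]
  intro S S' h
  ext x
  rw [← not_iff_not, ← hmem, ← hmem]
  exact iff_of_eq (congrArg (block (List.ofFn x) ∈ ·) h)

theorem two_pow_two_pow_le_card_of_accepts_freshWindowLanguage {S : Type*} [Fintype S] {N : ℕ}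
    {M : DFA (Fin 3) S} (hM : M.accepts = freshWindowLanguage (N + 1)) :
    2 ^ 2 ^ N ≤ Fintype.card S := by
  have hinj := injective_leftQuotient_freshWindowLanguage N
  rw [← hM] at hinj
  simpa using card_le_card_states_of_injective_leftQuotient M _ hinj

theorem RNN.two_pow_le_length_encode_of_lang_eq {F : RNNFormat} (R : RNN F 3) {N : ℕ}
    (hR : R.lang = freshWindowLanguage (N + 1)) : 2 ^ N ≤ R.encode.length := by
  obtain ⟨M, hM⟩ := R.exists_dfa_accepts_eq_lang
  have hcard := two_pow_two_pow_le_card_of_accepts_freshWindowLanguage (hM.trans hR)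
  rw [Fintype.card_fin, Nat.pow_le_pow_iff_right one_lt_two] at hcard
  exact hcard.trans R.precision_mul_dim_le_length_encode

end Blocks

section Attention

/-- The affine map `(v, a) ↦ P v + Q a + c`. -/
def Affine.ofPair {r s : ℕ} (P Q : Matrix (Fin s) (Fin r) ℚ) (c : Fin s → ℚ) :
    Affine (r + r) s where
  mat := fun k => Fin.append (P k) (Q k)
  bias := c

theorem Affine.ofPair_apply_append {r s : ℕ} (P Q : Matrix (Fin s) (Fin r) ℚ) (c : Fin s → ℚ)
    (v a : Fin r → ℚ) :
    (Affine.ofPair P Q c).apply (Fin.append v a) = P.mulVec v + Q.mulVec a + c := by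
  ext k
  simp only [Affine.ofPair, Affine.apply, Matrix.mulVec, dotProduct, Pi.add_apply,
    Fin.sum_univ_add, Fin.append_left, Fin.append_right]

variable {r s n : ℕ} {L : UHALayer r s}

theorem UHALayer.exists_attention_eq (v : Fin n → Fin r → ℚ) {i : Fin n}
    (h : (L.unmasked n i).Nonempty) :
    ∃ j ∈ L.unmasked n i, L.attention v i = v j ∧
      ∀ j' ∈ L.unmasked n i, L.score v i j' ≤ L.score v i j := by
  have hbest : L.tie.select (L.best v i) (L.best_nonempty v i h) ∈ L.best v i := by
    cases L.tie
    · exact Finset.min'_mem _ _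
    · exact Finset.max'_mem _ _
  obtain ⟨hj, hmax⟩ := Finset.mem_filter.1 hbest
  exact ⟨_, hj, dif_pos h, hmax⟩

theorem UHALayer.mem_unmasked_of_strictFuture (hL : L.mask = .strictFuture) {i j : Fin n} :
    j ∈ L.unmasked n i ↔ j < i := by
  simp [UHALayer.unmasked, hL, Mask.allows]

theorem UHALayer.attention_eq_zero_of_unmasked_eq_empty (v : Fin n → Fin r → ℚ) {i : Fin n}
    (h : L.unmasked n i = ∅) : L.attention v i = 0 :=
  dif_neg (Finset.not_nonempty_iff_eq_empty.2 h)

theorem UHALayer.unmasked_eq_empty_of_strictFuture (hL : L.mask = .strictFuture) {i : Fin n}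
    (hi : (i : ℕ) = 0) : L.unmasked n i = ∅ := by
  refine Finset.eq_empty_of_forall_notMem fun j hj => ?_
  rw [mem_unmasked_of_strictFuture hL, Fin.lt_def] at hj
  omega

theorem UHALayer.attention_eq_pred_of_strictFuture_of_rightmost (hmask : L.mask = .strictFuture)
    (htie : L.tie = .rightmost) {v : Fin n → Fin r → ℚ} {i j : Fin n} (hij : (i : ℕ) = j + 1)
    (hscore : ∀ j', L.score v i j' = L.score v i j) : L.attention v i = v j := by
  have hj : j ∈ L.unmasked n i := by
    rw [mem_unmasked_of_strictFuture hmask, Fin.lt_def]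
    omega
  have hbest : j ∈ L.best v i := Finset.mem_filter.2 ⟨hj, fun j' _ => (hscore j').le⟩
  have hmax : ∀ j' ∈ L.best v i, j' ≤ j := fun j' hj' => by
    have := (mem_unmasked_of_strictFuture hmask).1 (Finset.mem_filter.1 hj').1
    rw [Fin.lt_def] at this
    rw [Fin.le_def]
    omega
  have hselect : L.tie.select (L.best v i) ⟨j, hbest⟩ = j := by
    rw [htie]
    exact le_antisymm (Finset.max'_le _ _ _ hmax) (Finset.le_max' _ _ hbest)
  rw [UHALayer.attention, dif_pos ⟨j, hj⟩, hselect]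

end Attention

section WindowComputation

/-- The layer that prepends the bit of a position to the window of the preceding position. The
coordinates of a vector are the bit, the separator flag, the window value `x`, and two numbers
`p`, `z` with `p + z / 2 = x ^ 2`; the last one is to be passed through a ReLU layer. -/
def shiftLayer : UHALayer 5 5 where
  width_pos := by norm_num
  A := ⟨0, 0⟩
  B := ⟨0, 0⟩
  C := Affine.ofPair
    !![1, 0, 0, 0, 0; 0, 1, 0, 0, 0; 1/2, 0, 0, 0, 0; 1/4, 0, 0, 0, 0; 1, 0, 0, 0, 0]
    !![0, 0, 0, 0, 0; 0, 0, 0, 0, 0; 0, 0, 1/2, 0, 0; 0, 0, 0, 1/4, 1/8; 0, 0, 1, 0, 0]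
    ![0, 0, 0, 0, -1]
  mask := .strictFuture
  tie := .rightmost

/-- One round of the window computation: the shift layer, followed by the ReLU layer on the last
coordinate. -/
def shiftStep {n : ℕ} (v : Fin n → Fin 5 → ℚ) : Fin n → Fin 5 → ℚ := reluRun 4 (shiftLayer.run v)

theorem shiftStep_apply {n : ℕ} (v : Fin n → Fin 5 → ℚ) (i : Fin n) :
    shiftStep v i =
      ![v i 0, v i 1, (v i 0 + shiftLayer.attention v i 2) / 2,
        (v i 0 + (shiftLayer.attention v i 3 + shiftLayer.attention v i 4 / 2)) / 4,
        max 0 (v i 0 + shiftLayer.attention v i 2 - 1)] := by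
  have hC : shiftLayer.run v i = _ := Affine.ofPair_apply_append _ _ _ _ _
  rw [shiftStep, reluRun, hC]
  ext k
  fin_cases k <;> simp [dotProduct, Fin.sum_univ_five] <;> ring_nf

theorem attention_shiftLayer {n : ℕ} (v : Fin n → Fin 5 → ℚ) {i j : Fin n}
    (hij : (i : ℕ) = j + 1) : shiftLayer.attention v i = v j :=
  UHALayer.attention_eq_pred_of_strictFuture_of_rightmost rfl rfl hij fun j' => by
    simp [UHALayer.score, shiftLayer, Affine.apply]

/-- The vectors computed on the word `w` after `t` rounds, up to the choice of the last two
coordinates, of which only the combination that equals the square of the window value matters. -/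
structure EncodesWindows (w : List (Fin 3)) (t : ℕ) (v : Fin w.length → Fin 5 → ℚ) : Prop where
  bit : ∀ i, v i 0 = (decide (w.get i = 1)).toNat
  separator : ∀ i, v i 1 = (decide (w.get i = 2)).toNat
  window : ∀ i, v i 2 = windowValue t (w.take (i + 1))
  square : ∀ i, v i 3 + v i 4 / 2 = v i 2 ^ 2

namespace EncodesWindows

variable {w : List (Fin 3)} {t : ℕ} {v : Fin w.length → Fin 5 → ℚ}

theorem attention_window (hv : EncodesWindows w t v) (i : Fin w.length) :
    shiftLayer.attention v i 2 = windowValue t (w.take i) ∧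
      shiftLayer.attention v i 3 + shiftLayer.attention v i 4 / 2 =
        shiftLayer.attention v i 2 ^ 2 := by
  obtain ⟨_ | j, hi⟩ := i
  · rw [UHALayer.attention_eq_zero_of_unmasked_eq_empty v
      (UHALayer.unmasked_eq_empty_of_strictFuture rfl rfl)]
    simp [windowValue_nil]
  · rw [attention_shiftLayer v (j := ⟨j, by omega⟩) rfl]
    exact ⟨hv.window _, hv.square _⟩

theorem shiftStep (hv : EncodesWindows w t v) : EncodesWindows w (t + 1) (shiftStep v) where
  bit i := by simpa [shiftStep_apply] using hv.bit i
  separator i := by simpa [shiftStep_apply] using hv.separator i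
  window i := by
    have htake : w.take (i + 1) = w.take i ++ [w.get i] := List.take_succ_eq_append_getElem i.2
    rw [htake, windowValue_succ_concat, ← hv.bit, ← (hv.attention_window i).1, shiftStep_apply]
    rfl
  square i := by
    obtain ⟨hwindow, hsquare⟩ := hv.attention_window i
    have hmixed : max 0 (v i 0 + shiftLayer.attention v i 2 - 1) =
        v i 0 * shiftLayer.attention v i 2 := by
      rw [hv.bit, hwindow]
      exact max_zero_toNat_add_sub_one _ (windowValue_mem_Ico _ _)
    have hbit : v i 0 ^ 2 = v i 0 := by
      rw [hv.bit]
      cases decide (w.get i = 1) <;> norm_num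
    simp only [shiftStep_apply, hmixed, hsquare, Matrix.cons_val]
    linear_combination (-1 / 4) * hbit

theorem iterate_shiftStep (hv : EncodesWindows w 0 v) (t : ℕ) :
    EncodesWindows w t (Succinct.shiftStep^[t] v) := by
  induction t with
  | zero => exact hv
  | succ t ih => rw [Function.iterate_succ_apply']; exact ih.shiftStep

end EncodesWindows

end WindowComputation

section WindowComparison

/-- The layer that attends to a separator with a window as close as possible to the current one,
and outputs the difference `δ` of the two window values, `-δ`, and `0` or `1` according to whether
the attended position is a separator. The square in the score makes closeness bilinear. -/
def matchLayer : UHALayer 5 3 where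
  width_pos := by norm_num
  A := ⟨!![0, 0, 2, 0, 0; 0, 0, 0, 0, 0; 0, 0, 0, 0, 0; 0, 0, 0, 0, 0; 0, 0, 0, 0, 0],
    ![0, 1, 0, 0, 0]⟩
  B := ⟨!![0, 0, 1, 0, 0; 0, 2, 0, -1, -1/2; 0, 0, 0, 0, 0; 0, 0, 0, 0, 0; 0, 0, 0, 0, 0], 0⟩
  C := Affine.ofPair
    !![0, 0, 1, 0, 0; 0, 0, -1, 0, 0; 0, 0, 0, 0, 0]
    !![0, 0, -1, 0, 0; 0, 0, 1, 0, 0; 0, -1, 0, 0, 0]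
    ![0, 0, 1]
  mask := .strictFuture
  tie := .rightmost

/-- The layers that compare windows: the sum of the three output coordinates is positive unless the
attended position is a separator with the current window value. -/
def matchLayers : Layers 5 3 := .uha matchLayer (.relu 0 (.relu 1 (.nil 3)))

theorem score_matchLayer {n : ℕ} (v : Fin n → Fin 5 → ℚ) (i j : Fin n) :
    matchLayer.score v i j = 2 * v i 2 * v j 2 - (v j 3 + v j 4 / 2) + 2 * v j 1 := by
  simp [UHALayer.score, matchLayer, Affine.apply, dotProduct, Fin.sum_univ_five]
  ring

theorem dotProduct_run_matchLayers {n : ℕ} (v : Fin n → Fin 5 → ℚ) (i : Fin n) :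
    dotProduct 1 (matchLayers.run v i) =
      |v i 2 - matchLayer.attention v i 2| + (1 - matchLayer.attention v i 1) := by
  have hC : matchLayer.run v i = ![v i 2 - matchLayer.attention v i 2,
      -(v i 2 - matchLayer.attention v i 2), 1 - matchLayer.attention v i 1] := by
    refine (Affine.ofPair_apply_append _ _ _ _ _).trans ?_
    ext k
    fin_cases k <;> simp [dotProduct, Fin.sum_univ_five] <;> ring
  rw [← max_zero_add_max_neg_zero_eq_abs_self]
  simp [matchLayers, Layers.run, reluRun, hC, dotProduct, Fin.sum_univ_three,
    Function.update_apply, max_comm]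

theorem abs_sub_add_one_sub_toNat_pos_iff (b : Bool) (p q : ℚ) :
    0 < |p - q| + (1 - b.toNat) ↔ ¬(b = true ∧ q = p) := by
  cases b
  · simpa using add_pos_of_nonneg_of_pos (abs_nonneg (p - q)) one_pos
  · simp [sub_eq_zero, eq_comm]

theorem eq_true_and_eq_of_two_le {b : Bool} {p q : ℚ} (h : 2 ≤ 2 * b.toNat - (p - q) ^ 2) :
    b = true ∧ q = p := by
  have hsq := sq_nonneg (p - q)
  cases b
  · norm_num at h
    linarith
  · have hzero : (p - q) ^ 2 = 0 := le_antisymm (by simpa using h) hsq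
    exact ⟨rfl, (sub_eq_zero.1 (pow_eq_zero_iff two_ne_zero |>.1 hzero)).symm⟩

namespace EncodesWindows

variable {w : List (Fin 3)} {t : ℕ} {v : Fin w.length → Fin 5 → ℚ}

theorem score_matchLayer (hv : EncodesWindows w t v) (i j : Fin w.length) :
    matchLayer.score v i j =
      v i 2 ^ 2 - (v i 2 - v j 2) ^ 2 + 2 * (decide (w.get j = 2)).toNat := by
  rw [Succinct.score_matchLayer, hv.square, hv.separator]
  ring

theorem matchLayers_pos_iff (hv : EncodesWindows w t v) (i : Fin w.length) :
    0 < dotProduct 1 (matchLayers.run v i) ↔ ∀ j < i, w.get j = 2 → v j 2 ≠ v i 2 := by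
  rw [dotProduct_run_matchLayers]
  rcases (matchLayer.unmasked w.length i).eq_empty_or_nonempty with hempty | hne
  · have hnone : ∀ j, ¬j < i := fun j => by
      rw [← UHALayer.mem_unmasked_of_strictFuture (L := matchLayer) rfl, hempty]
      exact Finset.notMem_empty j
    rw [UHALayer.attention_eq_zero_of_unmasked_eq_empty v hempty]
    refine iff_of_true ?_ fun j hj => absurd hj (hnone j)
    simpa using add_pos_of_nonneg_of_pos (abs_nonneg (v i 2)) one_pos
  obtain ⟨j, hj, hatt, hmax⟩ := UHALayer.exists_attention_eq v hne
  simp only [UHALayer.mem_unmasked_of_strictFuture (L := matchLayer) rfl,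
    hv.score_matchLayer] at hj hmax
  have hmatch : ∀ k < i, w.get k = 2 → v k 2 = v i 2 → w.get j = 2 ∧ v j 2 = v i 2 := by
    intro k hk hsep hwindow
    have hle := hmax k hk
    simp only [hwindow, hsep, decide_true, Bool.toNat_true, Nat.cast_one, sub_self] at hle
    rw [← decide_eq_true_iff (p := w.get j = 2)]
    exact eq_true_and_eq_of_two_le (by linarith)
  rw [hatt, hv.separator, abs_sub_add_one_sub_toNat_pos_iff, decide_eq_true_iff]
  exact ⟨fun h k hk hsep hwindow => h (hmatch k hk hsep hwindow), fun h ⟨hsep, hwindow⟩ =>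
    h j hj hsep hwindow⟩

end EncodesWindows

end WindowComparison

section Transformer

/-- The token embedding: the bit and the separator flag of a letter, and an empty window. -/
def letterFeatures (a : Fin 3) : Fin 5 → ℚ :=
  ![(decide (a = 1)).toNat, (decide (a = 2)).toNat, 0, 0, 0]

theorem encodesWindows_letterFeatures (w : List (Fin 3)) :
    EncodesWindows w 0 fun i => letterFeatures (w.get i) where
  bit _ := rfl
  separator _ := rfl
  window _ := (windowValue_zero _).symm
  square _ := by simp [letterFeatures]

/-- `t` rounds of the window computation, followed by the comparison of windows. -/
def freshWindowLayers : ℕ → Layers 5 3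
  | 0 => matchLayers
  | t + 1 => .uha shiftLayer (.relu 4 (freshWindowLayers t))

theorem run_freshWindowLayers {n : ℕ} (t : ℕ) (v : Fin n → Fin 5 → ℚ) :
    (freshWindowLayers t).run v = matchLayers.run (shiftStep^[t] v) := by
  induction t generalizing v with
  | zero => rfl
  | succ _ ih => exact ih (shiftStep v)

/-- The transformer for the words with a fresh window of length `t`. -/
def freshWindowUHAT (t : ℕ) : UHAT 3 where
  d := 5
  d_pos := by norm_num
  s := 3
  emb := letterFeatures
  layers := freshWindowLayers t
  acc := 1
  out := .last

theorem forall_take_iff_forall_concat_isPrefix {α : Type*} {w : List α} {a : α}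
    {P : List α → Prop} :
    (∀ j : Fin w.length, (j : ℕ) < w.length - 1 → w.get j = a → P (w.take (j + 1))) ↔
      ∀ u, u ++ [a] <+: w → u ++ [a] ≠ w → P (u ++ [a]) := by
  constructor
  · rintro h u ⟨s, rfl⟩ hne
    have hs : s ≠ [] := fun hs => hne (by rw [hs, List.append_nil])
    have hpos := List.length_pos_iff.2 hs
    have htake : (u ++ [a] ++ s).take (u.length + 1) = u ++ [a] := List.take_left' (by simp)
    rw [← htake]
    exact h ⟨u.length, by simp⟩ (by simp; omega) (by simp)
  · intro h j hj hget
    have htake : w.take j ++ [a] = w.take (j + 1) := by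
      rw [← hget]
      exact (List.take_succ_eq_append_getElem j.2).symm
    rw [← htake]
    refine h _ (htake ▸ List.take_prefix _ _) fun heq => ?_
    have hlen := congrArg List.length heq
    rw [htake, List.length_take] at hlen
    omega

theorem lang_freshWindowUHAT (t : ℕ) : (freshWindowUHAT t).lang = freshWindowLanguage t := by
  ext w
  rcases eq_or_ne w [] with rfl | hw
  · exact iff_of_false (fun ⟨h, _⟩ => Nat.lt_irrefl 0 h) fun ⟨h, _⟩ => h rfl
  have hlen : 0 < w.length := List.length_pos_iff.2 hw
  have hv := (encodesWindows_letterFeatures w).iterate_shiftStep t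
  have hlast : w.take (w.length - 1 + 1) = w := List.take_of_length_le (by omega)
  calc w ∈ (freshWindowUHAT t).lang
      ↔ 0 < dotProduct 1 ((freshWindowLayers t).run (fun i => letterFeatures (w.get i))
          ⟨w.length - 1, by omega⟩) := exists_prop_of_true hlen
    _ ↔ ∀ j : Fin w.length, (j : ℕ) < w.length - 1 → w.get j = 2 →
          windowValue t (w.take (j + 1)) ≠ windowValue t w := by
        rw [run_freshWindowLayers, hv.matchLayers_pos_iff]
        simp only [Fin.lt_def, hv.window, hlast]
    _ ↔ ∀ u, u ++ [2] <+: w → u ++ [2] ≠ w → windowValue t (u ++ [2]) ≠ windowValue t w :=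
        forall_take_iff_forall_concat_isPrefix (P := fun u => windowValue t u ≠ windowValue t w)
    _ ↔ w ∈ freshWindowLanguage t := (and_iff_right hw).symm

theorem exists_length_encode_freshWindowUHAT :
    ∃ a b : ℕ, ∀ t, (freshWindowUHAT t).encode.length = a + b * t := by
  obtain ⟨b, hb⟩ : ∃ b, ∀ t, (freshWindowLayers t).encode.length =
      matchLayers.encode.length + b * t := by
    refine ⟨4 + shiftLayer.encode.length + (encNat ((4 : Fin 5) : ℕ)).length, fun t => ?_⟩
    induction t with
    | zero => rw [mul_zero, add_zero, freshWindowLayers]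
    | succ t ih =>
      simp only [freshWindowLayers, Layers.encode, List.length_append, ih, List.length_cons,
        List.length_nil]
      ring
  refine ⟨(freshWindowUHAT 0).encode.length, b, fun t => ?_⟩
  have hlayers : (freshWindowLayers t).encode.length =
      (freshWindowLayers 0).encode.length + b * t := hb t
  simp only [UHAT.encode, freshWindowUHAT, List.length_append, hlayers]
  ring

theorem canBeExpMoreSuccinct_uhat_rnn : CanBeExpMoreSuccinct uhatClass rnnClass := by
  obtain ⟨a, b, hsize⟩ := exists_length_encode_freshWindowUHAT
  refine canBeExpMoreSuccinct_of_linear_of_exponential (fun N => freshWindowUHAT (N + 1))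
    (a + b) b (fun N => ?_) fun N R hR => ?_
  · exact (hsize (N + 1)).trans_le (by linarith)
  · exact R.2.two_pow_le_length_encode_of_lang_eq (hR.trans (lang_freshWindowUHAT _))

end Transformer

end Succinct

theorem mainTheorem5 :
    (∀ (F : Succinct.RNNFormat) (σ : ℕ) (R : Succinct.RNN F σ),
      ∃ A : DFA (Fin σ) (Fin (2 ^ (R.precision * R.dim))), A.accepts = R.lang) ∧
    Succinct.CanBeExpMoreSuccinct Succinct.uhatClass Succinct.rnnClass :=
  ⟨fun _ _ R => R.exists_dfa_accepts_eq_lang, Succinct.canBeExpMoreSuccinct_uhat_rnn⟩
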